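/- Let $\mathfrak g$ be a (finite-dimensional) simple complex Lie algebra, let $G$ be the simple connected simply connected complex Lie group with Lie algebra $\mathfrak g$, and let $\mathfrak k\subset\mathfrak g$ be a fixed compact real form, that is, a real Lie subalgebra with $\mathfrak g=\mathfrak k\oplus i\mathfrak k$ on which the Killing form is negative definite. Let $\mathcal O=\mathrm{Ad}(G)e_0\subset\mathfrak g$ be a nonzero nilpotent orbit ($e_0\neq 0$ and $\mathrm{ad}(e_0)$ nilpotent). The height $\mathrm{ht}(\mathcal O)$ is the maximal integer $k$ such that $\mathrm{ad}(e)^k\ne 0$ for $e\in\mathcal O$ (it does not depend on the choice of $e$). An $\mathfrak{sl}_2$-triple is a triple $\langle e,h,f\rangle$ of elements of $\mathfrak g$ with $[e,f]=h$, $[h,e]=2e$, $[h,f]=-2f$. The orbit $\mathcal O$ is called a Moore–Penrose orbit if for every $e\in\mathcal O$ there is an $\mathfrak{sl}_2$-triple $\langle e,h,f\rangle$ with $h\in i\mathfrak k$. Then $\mathcal O$ is a Moore–Penrose orbit if and only if $\mathrm{ht}(\mathcal O)=2$. In this case, for every $e\in\mathcal O$ there exists a unique $\mathfrak{sl}_2$-triple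 $\langle e,h,f\rangle$ with $h\in i\mathfrak k$. -/

import Mathlib

open scoped Pointwise

noncomputable section

/-- The adjoint group `Ad(G) ⊆ GL(𝔤)` of a connected complex Lie group `G` with finite-dimensional
Lie algebra `𝔤`: the group generated by the operators `exp (ad x)`, `x ∈ 𝔤` (recall that
`Ad (exp x) = exp (ad x)` and that a connected Lie group is generated by the image of `exp`).
That `φ` is `exp (ad x)` is written out: `φ` is the sum of the exponential series of `ad x`, for the
canonical topology of the finite-dimensional complex vector space `End 𝔤`. -/
def adjointGroup (𝔤 : Type*) [LieRing 𝔤] [LieAlgebra ℂ 𝔤] : Subgroup (𝔤 ≃ₗ[ℂ] 𝔤) :=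
  letI : TopologicalSpace (Module.End ℂ 𝔤) := moduleTopology ℂ (Module.End ℂ 𝔤)
  Subgroup.closure
    {φ | ∃ x : 𝔤, HasSum (fun n : ℕ => (n.factorial : ℂ)⁻¹ • LieAlgebra.ad ℂ 𝔤 x ^ n)
      (φ : Module.End ℂ 𝔤)}

/-- A nilpotent orbit: the orbit `Ad(G) e` of an `ad`-nilpotent element `e`. -/
def IsNilpotentOrbit {𝔤 : Type*} [LieRing 𝔤] [LieAlgebra ℂ 𝔤] (O : Set 𝔤) : Prop :=
  ∃ e : 𝔤, IsNilpotent (LieAlgebra.ad ℂ 𝔤 e) ∧ O = MulAction.orbit (adjointGroup 𝔤) e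

/-- The height of a nilpotent orbit: the maximal `k` such that `ad(e) ^ k ≠ 0` for `e` in the orbit
(`k` does not depend on the choice of `e`). -/
def orbitHeight {𝔤 : Type*} [LieRing 𝔤] [LieAlgebra ℂ 𝔤] (O : Set 𝔤) : ℕ :=
  sSup {k : ℕ | ∃ e ∈ O, LieAlgebra.ad ℂ 𝔤 e ^ k ≠ 0}

/-- A compact real form `𝔨` of a semisimple complex Lie algebra `𝔤`: a real Lie subalgebra
with `𝔤 = 𝔨 ⊕ i𝔨` on which the Killing form is negative definite. (The Killing form of `𝔤` is
real-valued on a real form, where it agrees with the Killing form of that real form.) -/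
structure IsCompactRealForm {𝔤 : Type*} [LieRing 𝔤] [LieAlgebra ℂ 𝔤]
    (𝔨 : Submodule ℝ 𝔤) : Prop where
  lie_mem : ∀ x ∈ 𝔨, ∀ y ∈ 𝔨, ⁅x, y⁆ ∈ 𝔨
  isCompl : IsCompl 𝔨 (Complex.I • 𝔨)
  neg_def : ∀ x ∈ 𝔨, x ≠ 0 → (killingForm ℂ 𝔤 x x).re < 0

/-- The orbit `O` is a Moore–Penrose orbit with respect to the compact real form `𝔨`: every `e ∈ O`
lies in an `sl₂`-triple `⟨e, h, f⟩` with `h ∈ i𝔨`. (The condition `h ≠ 0` in `IsSl2Triple` follows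
from the relation `[h, e] = 2e` as soon as `e ≠ 0`.) -/
def IsMoorePenroseOrbit {𝔤 : Type*} [LieRing 𝔤] [LieAlgebra ℂ 𝔤]
    (𝔨 : Submodule ℝ 𝔤) (O : Set 𝔤) : Prop :=
  ∀ e ∈ O, ∃ h f : 𝔤, IsSl2Triple h e f ∧ h ∈ Complex.I • 𝔨

end

/-!
Let `κ` be the Killing form and `σ` the conjugation with respect to `𝔨`. The Hermitian form
`κ(x, σ y)` is negative definite, so `κ` is anisotropic on `i𝔨`. Two characteristics `h`, `h'` of
`e` differ by an element of `ker (ad e) ∩ im (ad e)`, where `κ` vanishes; this gives uniqueness.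

If `(ad e) ^ 3 = 0`, choose the characteristic `h` that is orthogonal to `ker (ad e) ∩ im (ad e)`
for the Hermitian form. Then `σ h ∈ ker (ad e) + im (ad e)`, which `ad h` maps into
`ker (ad e) ∩ im (ad e)`, so `[h, σ h]` is an isotropic element of `i𝔨` and vanishes. Hence `ad h`
is a normal operator with integral eigenvalues, which forces `σ h = -h`.

If `(ad e) ^ 3 ≠ 0` and `h ∈ i𝔨`, a highest weight vector of maximal weight yields `x ∈ im (ad e)`
with `[h, x] = k x`, `k ≠ 0` and `[e, x] ≠ 0`. The element `g = exp (ad x)` fixes `x` and moves `h`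
to `h - k x`, so every characteristic of `g e` has the form `h + g (z - k x)` with
`z ∈ ker (ad e) ∩ im (ad e)`. Since `κ(z - k x, z - k x) = 0`, it lies in `i𝔨` only if `z = k x`,
which is absurd because `x` is not in `ker (ad e)`.
-/

open LieAlgebra Finset.HasAntidiagonal

section CauchyProduct

variable {𝕜 E F G : Type*} [NontriviallyNormedField 𝕜]
  [SeminormedAddCommGroup E] [NormedSpace 𝕜 E] [SeminormedAddCommGroup F] [NormedSpace 𝕜 F]
  [NormedAddCommGroup G] [NormedSpace 𝕜 G] [CompleteSpace G]

lemma hasSum_sum_antidiagonal_apply₂ (B : E →L[𝕜] F →L[𝕜] G) {f : ℕ → E} {g : ℕ → F} {a : E} {b : F}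
    (hf : HasSum f a) (hg : HasSum g b) (hf' : Summable fun n => ‖f n‖)
    (hg' : Summable fun n => ‖g n‖) :
    HasSum (fun n => ∑ kl ∈ antidiagonal n, B (f kl.1) (g kl.2)) (B a b) := by
  have hsum : Summable fun kl : ℕ × ℕ => B (f kl.1) (g kl.2) := by
    refine .of_norm_bounded (g := fun kl => ‖B‖ * (‖f kl.1‖ * ‖g kl.2‖))
      ((hf'.mul_of_nonneg hg' (fun _ => norm_nonneg _) fun _ => norm_nonneg _).mul_left _) ?_
    intro kl
    rw [← mul_assoc]
    exact B.le_opNorm₂ _ _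
  have hprod : HasSum (fun kl : ℕ × ℕ => B (f kl.1) (g kl.2)) (B a b) := by
    have hrow := hsum.hasSum.prod_fiberwise fun k => (B (f k)).hasSum hg
    have hcol : HasSum (fun k => B (f k) b) (B a b) := (B.flip b).hasSum hf
    rw [hcol.unique hrow]
    exact hsum.hasSum
  rw [← Finset.HasAntidiagonal.sigmaAntidiagonalEquivProd.hasSum_iff] at hprod
  exact hprod.sigma fun n => (antidiagonal n).hasSum (fun kl => B (f kl.1) (g kl.2))

end CauchyProduct

lemma inv_factorial_smul_ad_pow_lie {K L : Type*} [Field K] [CharZero K] [LieRing L]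
    [LieAlgebra K L] (x a b : L) (n : ℕ) :
    (n.factorial : K)⁻¹ • (ad K L x ^ n) ⁅a, b⁆ =
      ∑ kl ∈ antidiagonal n, ⁅(kl.1.factorial : K)⁻¹ • (ad K L x ^ kl.1) a,
        (kl.2.factorial : K)⁻¹ • (ad K L x ^ kl.2) b⁆ := by
  rw [ad_pow_lie, Finset.smul_sum]
  refine Finset.sum_congr rfl fun kl hkl => ?_
  obtain rfl := mem_antidiagonal.mp hkl
  have hchoose : ((kl.1 + kl.2).choose kl.1 : K) * kl.1.factorial * kl.2.factorial
      = (kl.1 + kl.2).factorial := by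
    rw [Nat.choose_symm_add]
    exact_mod_cast Nat.add_choose_mul_factorial_mul_factorial kl.1 kl.2
  have hne (m : ℕ) : (m.factorial : K) ≠ 0 := by exact_mod_cast m.factorial_ne_zero
  rw [smul_lie, lie_smul, ← Nat.cast_smul_eq_nsmul K, smul_smul, smul_smul]
  congr 1
  field_simp [hne]
  linear_combination hchoose

section Exponential

variable {𝔤 : Type*} [LieRing 𝔤] [LieAlgebra ℂ 𝔤] [FiniteDimensional ℂ 𝔤]

lemma map_lie_of_hasSum_exp [TopologicalSpace (Module.End ℂ 𝔤)]
    [IsModuleTopology ℂ (Module.End ℂ 𝔤)] {x : 𝔤} {φ : Module.End ℂ 𝔤}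
    (hφ : HasSum (fun n : ℕ => (n.factorial : ℂ)⁻¹ • ad ℂ 𝔤 x ^ n) φ) (a b : 𝔤) :
    φ ⁅a, b⁆ = ⁅φ a, φ b⁆ := by
  let v := (Module.finBasis ℂ 𝔤).equivFun
  let _ := NormedAddCommGroup.induced 𝔤 _ v v.injective
  let _ := NormedSpace.induced ℂ 𝔤 _ v
  have happly (c : 𝔤) :
      HasSum (fun n : ℕ => (n.factorial : ℂ)⁻¹ • (ad ℂ 𝔤 x ^ n) c) (φ c) :=
    hφ.map (LinearMap.applyₗ c) (IsModuleTopology.continuous_of_linearMap _)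
  have : CompleteSpace 𝔤 := FiniteDimensional.complete ℂ 𝔤
  have hprod := hasSum_sum_antidiagonal_apply₂
    ((LieModule.toEnd ℂ 𝔤 𝔤 : 𝔤 →ₗ[ℂ] 𝔤 →ₗ[ℂ] 𝔤).toContinuousBilinearMap) (happly a) (happly b)
    (summable_norm_iff.mpr (happly a).summable) (summable_norm_iff.mpr (happly b).summable)
  exact (happly ⁅a, b⁆).unique <| hprod.congr_fun fun n => inv_factorial_smul_ad_pow_lie x a b n

/-- An element of the adjoint group, as an automorphism of the Lie algebra. -/
noncomputable def adjointGroup.toLieEquiv (g : adjointGroup 𝔤) : 𝔤 ≃ₗ⁅ℂ⁆ 𝔤 where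
  __ := g.1
  map_lie' {a b} := by
    let _ : TopologicalSpace (Module.End ℂ 𝔤) := moduleTopology ℂ (Module.End ℂ 𝔤)
    have : IsModuleTopology ℂ (Module.End ℂ 𝔤) := ⟨rfl⟩
    obtain ⟨g, hg⟩ := g
    change g ⁅a, b⁆ = ⁅g a, g b⁆
    induction hg using Subgroup.closure_induction generalizing a b with
    | mem φ h => obtain ⟨x, hx⟩ := h; exact map_lie_of_hasSum_exp hx a b
    | one => rfl
    | mul g₁ g₂ _ _ h₁ h₂ => simp only [LinearEquiv.mul_apply, h₁, h₂]
    | inv g _ h =>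
      refine g.injective ?_
      simp only [h]
      simp [LinearEquiv.apply_symm_apply]

lemma exists_linearEquiv_hasSum_exp {V : Type*} [AddCommGroup V] [Module ℂ V]
    [FiniteDimensional ℂ V] [TopologicalSpace (Module.End ℂ V)]
    [IsModuleTopology ℂ (Module.End ℂ V)] (T : Module.End ℂ V) :
    ∃ φ : V ≃ₗ[ℂ] V, HasSum (fun n : ℕ => (n.factorial : ℂ)⁻¹ • T ^ n) (φ : Module.End ℂ V) := by
  let v := (Module.finBasis ℂ V).equivFun
  let _ := NormedAddCommGroup.induced V _ v v.injective
  let _ := NormedSpace.induced ℂ V _ v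
  have : CompleteSpace V := FiniteDimensional.complete ℂ V
  have : IsTopologicalAddGroup (Module.End ℂ V) := IsModuleTopology.topologicalAddGroup ℂ _
  have : ContinuousSMul ℂ (Module.End ℂ V) := IsModuleTopology.toContinuousSMul ℂ _
  let _ : NormedAlgebra ℚ (V →L[ℂ] V) := .restrictScalars ℚ ℂ _
  let toEnd : (V →L[ℂ] V) ≃ₐ[ℂ] Module.End ℂ V := (Module.End.toContinuousLinearMap V).symm
  let S := Module.End.toContinuousLinearMap V T
  have hS : HasSum (fun n : ℕ => (n.factorial : ℂ)⁻¹ • T ^ n) (toEnd (NormedSpace.exp S)) := by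
    simpa [Function.comp_def, toEnd, S] using (NormedSpace.exp_series_hasSum_exp' (𝕂 := ℂ) S).map
      toEnd (LinearMap.continuous_of_finiteDimensional toEnd.toLinearMap)
  obtain ⟨u, hu⟩ := (NormedSpace.isUnit_exp S).map toEnd
  refine ⟨LinearMap.GeneralLinearGroup.generalLinearEquiv ℂ V u, ?_⟩
  rwa [LinearMap.GeneralLinearGroup.generalLinearEquiv_to_linearMap, hu]

lemma adjointGroup.exists_toLieEquiv_apply_eq_add_lie (x : 𝔤) :
    ∃ g : adjointGroup 𝔤, ∀ y, ⁅x, ⁅x, y⁆⁆ = 0 → toLieEquiv g y = y + ⁅x, y⁆ := by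
  let _ : TopologicalSpace (Module.End ℂ 𝔤) := moduleTopology ℂ (Module.End ℂ 𝔤)
  have : IsModuleTopology ℂ (Module.End ℂ 𝔤) := ⟨rfl⟩
  obtain ⟨φ, hφ⟩ := exists_linearEquiv_hasSum_exp (ad ℂ 𝔤 x)
  refine ⟨⟨φ, Subgroup.subset_closure ⟨x, hφ⟩⟩, fun y hy => ?_⟩
  let v := (Module.finBasis ℂ 𝔤).equivFun
  let _ := NormedAddCommGroup.induced 𝔤 _ v v.injective
  let _ := NormedSpace.induced ℂ 𝔤 _ v
  have happly : HasSum (fun n : ℕ => (n.factorial : ℂ)⁻¹ • (ad ℂ 𝔤 x ^ n) y) (φ y) :=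
    hφ.map (LinearMap.applyₗ y) (IsModuleTopology.continuous_of_linearMap _)
  have hvanish : ∀ n ∉ Finset.range 2, (n.factorial : ℂ)⁻¹ • (ad ℂ 𝔤 x ^ n) y = 0 := by
    intro n hn
    obtain ⟨m, rfl⟩ := Nat.exists_eq_add_of_le (not_lt.mp (mt Finset.mem_range.mpr hn))
    rw [add_comm, pow_add]
    simp [sq, hy]
  simpa [Finset.sum_range_succ] using! happly.unique (hasSum_sum_of_ne_finset_zero hvanish)

end Exponential

section Ring

variable {A : Type*} [Ring A] {a b : A}

lemma mul_lie (a b c : A) : ⁅a * b, c⁆ = a * ⁅b, c⁆ + ⁅a, c⁆ * b := by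
  simp only [Ring.lie_def]; noncomm_ring

lemma lie_pow_succ_of_commute (h : Commute a ⁅a, b⁆) (n : ℕ) :
    ⁅a ^ (n + 1), b⁆ = (n + 1) • (a ^ n * ⁅a, b⁆) := by
  induction n with
  | zero => simp
  | succ n ih =>
    rw [pow_succ' a (n + 1), mul_lie, ih, mul_smul_comm, ← mul_assoc, ← pow_succ',
      ← (h.pow_left (n + 1)).eq, succ_nsmul _ (n + 1)]

/-- Jacobson's lemma: bracketing `a ^ (k + 1) * ⁅a, b⁆ ^ m = 0` with `b` trades a power of `a` for
powers of `⁅a, b⁆`. -/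
lemma isNilpotent_lie_of_commute [IsAddTorsionFree A] (ha : IsNilpotent a)
    (h : Commute a ⁅a, b⁆) : IsNilpotent ⁅a, b⁆ := by
  set c := ⁅a, b⁆ with hc
  have descend (k m : ℕ) (hk : a ^ (k + 1) * c ^ m = 0) : a ^ k * c ^ (2 * m + 1) = 0 := by
    have hcm : c ^ m * ⁅a ^ (k + 1), b⁆ * c ^ m = 0 := by
      rw [Ring.lie_def, mul_sub, sub_mul, ← mul_assoc, (h.pow_pow (k + 1) m).symm.eq, hk,
        zero_mul, zero_mul, mul_assoc, mul_assoc, hk, mul_zero, mul_zero, sub_zero]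
    rw [lie_pow_succ_of_commute h, mul_smul_comm, smul_mul_assoc, ← hc,
      smul_eq_zero_iff_right k.succ_ne_zero, ← mul_assoc, ← (h.pow_pow k m).eq, mul_assoc,
      mul_assoc, ← pow_succ', ← pow_add] at hcm
    rwa [show 2 * m + 1 = m + (m + 1) by omega]
  obtain ⟨n, hn⟩ := ha
  have hall (k : ℕ) : ∀ m, a ^ k * c ^ m = 0 → IsNilpotent c := by
    induction k with
    | zero => exact fun m hm => ⟨m, by simpa using hm⟩
    | succ k ih => exact fun m hm => ih _ (descend k m hm)
  exact hall n 0 (by simp [hn])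

lemma mul_pow_mul_pow_of_commute (h : Commute a ⁅a, b⁆) (k j : ℕ) :
    (a * b) ^ j * a ^ k = a ^ k * (a * b - k • ⁅a, b⁆) ^ j := by
  have hstep : a * b * a ^ k = a ^ k * (a * b - k • ⁅a, b⁆) := by
    cases k with
    | zero => simp
    | succ k =>
      have hlie := lie_pow_succ_of_commute h k
      rw [Ring.lie_def _ b, sub_eq_iff_eq_add, ← sub_eq_iff_eq_add'] at hlie
      rw [mul_assoc, ← hlie, mul_sub, mul_sub, mul_smul_comm, mul_smul_comm, ← mul_assoc,
        ← mul_assoc, ← mul_assoc, ← pow_succ', ← pow_succ, ← pow_succ']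
  exact (SemiconjBy.pow_right (x := a * b - k • ⁅a, b⁆) (y := a * b) hstep.symm j).eq.symm

lemma dvd_sub_pow_of_commute (h : Commute a ⁅a, b⁆) (k j : ℕ) :
    a ∣ (a * b - k • ⁅a, b⁆) ^ j - (-(k • ⁅a, b⁆)) ^ j := by
  have hda : a * b * a = a * (a * b - ⁅a, b⁆) := by simp only [Ring.lie_def]; noncomm_ring
  induction j with
  | zero => simp
  | succ j ih =>
    obtain ⟨y, hy⟩ := ih
    refine ⟨(a * b - ⁅a, b⁆ - k • ⁅a, b⁆) * y + b * (-(k • ⁅a, b⁆)) ^ j, ?_⟩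
    have hTa : (a * b - k • ⁅a, b⁆) * a = a * (a * b - ⁅a, b⁆ - k • ⁅a, b⁆) := by
      rw [sub_mul, hda, mul_sub _ _ (k • _), smul_mul_assoc, mul_smul_comm, h.eq]
    rw [pow_succ', pow_succ', mul_add, ← mul_assoc a, ← hTa, mul_assoc, ← hy]
    noncomm_ring

lemma isNilpotent_mul_of_commute_lie [IsAddTorsionFree A] (ha : IsNilpotent a)
    (h : Commute a ⁅a, b⁆) : IsNilpotent (a * b) := by
  obtain ⟨m, hm⟩ := isNilpotent_lie_of_commute ha h
  have hdvd (k : ℕ) : a ^ k ∣ (a * b) ^ (m * k) := by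
    induction k with
    | zero => simp
    | succ k ih =>
      obtain ⟨y, hy⟩ := ih
      obtain ⟨z, hz⟩ := dvd_sub_pow_of_commute h k m
      rw [neg_pow, smul_pow, hm, smul_zero, mul_zero, sub_zero] at hz
      exact ⟨z * y, by rw [mul_add_one, add_comm, pow_add, hy, ← mul_assoc,
        mul_pow_mul_pow_of_commute h, hz]; simp only [pow_succ, mul_assoc]⟩
  obtain ⟨n, hn⟩ := ha
  exact ⟨m * n, zero_dvd_iff.mp (hn ▸ hdvd n)⟩

lemma lie_pow_succ_of_lie_eq_two_nsmul {e h f : A} (hef : ⁅e, f⁆ = h)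
    (hhe : ⁅h, e⁆ = 2 • e) (n : ℕ) :
    ⁅e ^ (n + 1), f⁆ = (n + 1) • ((h - n) * e ^ n) := by
  have heh : e * h = (h - 2) * e := by
    rw [Ring.lie_def] at hhe
    linear_combination (norm := noncomm_ring) -hhe
  induction n with
  | zero => simpa using hef
  | succ n ih =>
    rw [pow_succ' e (n + 1), mul_lie, ih, hef]
    have : e * ((h - n) * e ^ n) = (h - 2 - n) * e ^ (n + 1) := by
      rw [← mul_assoc, mul_sub, heh, ← (Nat.cast_commute n e).eq, ← sub_mul, mul_assoc, ← pow_succ']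
    rw [mul_smul_comm, this]
    push_cast
    simp only [nsmul_eq_mul, sub_mul, mul_sub]
    push_cast
    noncomm_ring

end Ring

section Weights

variable {K V : Type*} [Field K] [AddCommGroup V] [Module K V]

lemma isNilpotent_of_forall_hasEigenvalue_eq_zero [IsAlgClosed K] [FiniteDimensional K V]
    {T : Module.End K V} (hT : ∀ μ, T.HasEigenvalue μ → μ = 0) : IsNilpotent T := by
  have htop : T.maxGenEigenspace 0 = ⊤ := by
    rw [eq_top_iff, ← T.iSup_maxGenEigenspace_eq_top, iSup_le_iff]
    intro μ
    by_cases hμ : T.HasUnifEigenvalue μ ⊤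
    · rw [hT μ (hμ.lt zero_lt_one)]
    · rw [Module.End.maxGenEigenspace, not_ne_iff.mp hμ]
      exact bot_le
  refine ((LinearMap.charpoly_nilpotent_tfae T).out 0 2).mpr fun m => ?_
  simpa using (T.mem_maxGenEigenspace 0 m).mp (htop ▸ Submodule.mem_top)

variable [CharZero K] {E F H : Module.End K V}

lemma exists_eq_natCast_of_lie_relations_of_mem_ker (hE : IsNilpotent E) (hEF : ⁅E, F⁆ = H)
    (hHE : ⁅H, E⁆ = 2 • E) {z : V} (hz : z ≠ 0) (hEz : E z = 0) {μ : K} (hHz : H z = μ • z) :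
    ∃ n : ℕ, μ = n := by
  obtain ⟨N, hN⟩ := hE
  obtain ⟨n, ⟨w, rfl⟩, hn⟩ : ∃ n, z ∈ LinearMap.range (E ^ n) ∧
      z ∉ LinearMap.range (E ^ (n + 1)) := by
    by_contra! hall
    have hmem (n : ℕ) : z ∈ LinearMap.range (E ^ n) :=
      Nat.rec (by simp) (fun n ih => hall n ih) n
    obtain ⟨w, rfl⟩ := hmem N
    simp [hN] at hz
  have hkey : (E ^ (n + 1)) (F w) = ((n + 1) * (μ - n)) • (E ^ n) w := by
    have hlie := congr($(lie_pow_succ_of_lie_eq_two_nsmul hEF hHE n) w)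
    have hw : (E ^ (n + 1)) w = 0 := by rw [pow_succ', Module.End.mul_apply, hEz]
    simp only [Ring.lie_def, LinearMap.sub_apply, Module.End.mul_apply, hw, map_zero, sub_zero,
      LinearMap.smul_apply, hHz, Module.End.natCast_apply] at hlie
    rw [hlie]
    module
  refine ⟨n, by_contra fun hμ => hn ⟨((n + 1 : K) * (μ - n))⁻¹ • F w, ?_⟩⟩
  rw [map_smul, hkey, inv_smul_smul₀ (mul_ne_zero n.cast_add_one_ne_zero (sub_ne_zero.mpr hμ))]

lemma exists_eq_intCast_of_lie_relations (hE : IsNilpotent E) (hEF : ⁅E, F⁆ = H)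
    (hHE : ⁅H, E⁆ = 2 • E) {x : V} (hx : x ≠ 0) {μ : K} (hHx : H x = μ • x) :
    ∃ n : ℤ, μ = n := by
  have hpow (j : ℕ) : H ((E ^ j) x) = (μ + 2 * j) • (E ^ j) x := by
    induction j with
    | zero => simpa using hHx
    | succ j ih =>
      have hHE' := congr($hHE ((E ^ j) x))
      simp only [Ring.lie_def, LinearMap.sub_apply, Module.End.mul_apply, ih, map_smul,
        LinearMap.smul_apply, sub_eq_iff_eq_add] at hHE'
      rw [pow_succ', Module.End.mul_apply, hHE']
      push_cast
      module
  obtain ⟨j, hj, hj'⟩ : ∃ j, (E ^ j) x ≠ 0 ∧ (E ^ (j + 1)) x = 0 := by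
    by_contra! hall
    obtain ⟨N, hN⟩ := hE
    exact Nat.rec (motive := fun j => (E ^ j) x ≠ 0) (by simpa) hall N (by simp [hN])
  rw [pow_succ'] at hj'
  obtain ⟨n, hn⟩ := exists_eq_natCast_of_lie_relations_of_mem_ker hE hEF hHE hj hj' (hpow j)
  exact ⟨n - 2 * j, by push_cast; linear_combination hn⟩

end Weights

section Killing

variable {K L : Type*} [Field K] [LieRing L] [LieAlgebra K L]

lemma lie_ad_ad (x y : L) : ⁅ad K L x, ad K L y⁆ = ad K L ⁅x, y⁆ := by
  ext z
  simp [Ring.lie_def]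

lemma killingForm_lie_eq_zero_of_lie_eq_zero {e z : L} (hz : ⁅e, z⁆ = 0) (w : L) :
    killingForm K L ⁅e, w⁆ z = 0 := by
  rw [LieModule.traceForm_apply_lie_apply', hz, map_zero, neg_zero]

lemma killingForm_self_eq_zero_of_mem_ker_ad_inf_range_ad {e v : L}
    (hv : v ∈ LinearMap.ker (ad K L e) ⊓ LinearMap.range (ad K L e)) :
    killingForm K L v v = 0 := by
  obtain ⟨hker, w, rfl⟩ := hv
  exact killingForm_lie_eq_zero_of_lie_eq_zero hker w

lemma killingForm_self_eq_zero_of_lie_eq_smul [CharZero K] {h x : L} {k : K}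
    (hk : k ≠ 0) (hx : ⁅h, x⁆ = k • x) : killingForm K L x x = 0 := by
  have hκ := LieModule.traceForm_apply_lie_apply' K L L h x x
  rw [hx, map_smul, map_smul, LinearMap.smul_apply, self_eq_neg] at hκ
  exact (smul_eq_zero_iff_right hk).mp hκ

lemma killingForm_ad_pow_apply (x y z : L) (n : ℕ) :
    killingForm K L ((ad K L x ^ n) y) z = (-1) ^ n * killingForm K L y ((ad K L x ^ n) z) := by
  induction n generalizing z with
  | zero => simp
  | succ n ih =>
    rw [pow_succ', Module.End.mul_apply, ad_apply, LieModule.traceForm_apply_lie_apply', ih,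
      ← ad_apply K, ← Module.End.mul_apply, ← pow_succ, pow_succ', ← pow_succ']
    ring

lemma orthogonal_range_ad_pow [IsKilling K L] (x : L) (n : ℕ) :
    (killingForm K L).orthogonal (LinearMap.range (ad K L x ^ n)) =
      LinearMap.ker (ad K L x ^ n) := by
  ext z
  simp only [LinearMap.BilinForm.mem_orthogonal_iff, LinearMap.mem_range, forall_exists_index,
    forall_apply_eq_imp_iff, killingForm_ad_pow_apply, LinearMap.mem_ker,
    mul_eq_zero_iff_left (pow_ne_zero n (neg_ne_zero.mpr (one_ne_zero (α := K))))]
  exact ⟨fun h => (IsKilling.killingForm_nondegenerate K L).2 _ h, fun h => by simp [h]⟩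

variable [FiniteDimensional K L] [IsKilling K L]

lemma orthogonal_orthogonal_killingForm (W : Submodule K L) :
    (killingForm K L).orthogonal ((killingForm K L).orthogonal W) = W :=
  LinearMap.BilinForm.orthogonal_orthogonal (IsKilling.killingForm_nondegenerate K L)
    (LieModule.traceForm_isSymm K L L).isRefl W

lemma orthogonal_ker_ad_inf_range_ad_le (x : L) :
    (killingForm K L).orthogonal (LinearMap.ker (ad K L x) ⊓ LinearMap.range (ad K L x)) ≤
      LinearMap.ker (ad K L x) ⊔ LinearMap.range (ad K L x) := by
  rw [← orthogonal_orthogonal_killingForm (_ ⊔ _)]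
  have hrange : (killingForm K L).orthogonal (LinearMap.range (ad K L x)) =
      LinearMap.ker (ad K L x) := by simpa using orthogonal_range_ad_pow (K := K) x 1
  refine LinearMap.BilinForm.orthogonal_le (le_inf ?_ ?_)
  · exact (LinearMap.BilinForm.orthogonal_le le_sup_right).trans hrange.le
  · rw [← orthogonal_orthogonal_killingForm (LinearMap.range _), hrange]
    exact LinearMap.BilinForm.orthogonal_le le_sup_left

lemma exists_lie_lie_eq_self [CharZero K] {e : L} (he : IsNilpotent (ad K L e)) :
    ∃ y, ⁅e, ⁅e, y⁆⁆ = e := by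
  suffices e ∈ LinearMap.range (ad K L e ^ 2) by simpa [sq] using this
  rw [← orthogonal_orthogonal_killingForm (LinearMap.range _), orthogonal_range_ad_pow]
  intro z hz
  have hcomm : Commute (ad K L e) ⁅ad K L e, ad K L z⁆ := by
    rw [LinearMap.mem_ker, sq, Module.End.mul_apply, ad_apply, ad_apply] at hz
    rw [commute_iff_lie_eq, lie_ad_ad, lie_ad_ad, hz, map_zero]
  have : IsAddTorsionFree (Module.End K L) := .of_isTorsionFree K _
  rw [LieModule.traceForm_comm, killingForm_apply_apply]
  exact (LinearMap.isNilpotent_trace_of_isNilpotent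
    (isNilpotent_mul_of_commute_lie he hcomm)).eq_zero

end Killing

section Characteristic

variable {K L : Type*} [Field K] [LieRing L] [LieAlgebra K L] {e f h : L}

lemma isSl2Triple_map {L' : Type*} [LieRing L'] [LieAlgebra K L'] (g : L ≃ₗ⁅K⁆ L')
    (t : IsSl2Triple h e f) : IsSl2Triple (g h) (g e) (g f) where
  h_ne_zero := by simpa using t.h_ne_zero
  lie_e_f := by rw [← LieEquiv.map_lie, t.lie_e_f]
  lie_h_e_nsmul := by rw [← LieEquiv.map_lie, t.lie_h_e_nsmul, map_nsmul]
  lie_h_f_nsmul := by rw [← LieEquiv.map_lie, t.lie_h_f_nsmul, map_neg, map_nsmul]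

variable (K) in
lemma sub_mem_ker_ad_inf_range_ad {h' f' : L} (t : IsSl2Triple h e f) (t' : IsSl2Triple h' e f') :
    h - h' ∈ LinearMap.ker (ad K L e) ⊓ LinearMap.range (ad K L e) := by
  refine ⟨LinearMap.mem_ker.mpr ?_, f - f', by rw [ad_apply, lie_sub, t.lie_e_f, t'.lie_e_f]⟩
  rw [ad_apply, ← lie_skew, sub_lie, t.lie_h_e_nsmul, t'.lie_h_e_nsmul, sub_self, neg_zero]

lemma lie_lie_of_lie_eq_two_nsmul (hhe : ⁅h, e⁆ = 2 • e) (y : L) :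
    ⁅h, ⁅e, y⁆⁆ = ⁅e, ⁅h, y⁆ + 2 • y⁆ := by
  rw [leibniz_lie, hhe, nsmul_lie, lie_add, lie_nsmul, add_comm]

variable [CharZero K]

variable (K) in
lemma lie_ad_pow_succ_apply_of_lie_eq_two_nsmul (hef : ⁅e, f⁆ = h) (hhe : ⁅h, e⁆ = 2 • e)
    {n : ℕ} (he : ad K L e ^ (n + 1) = 0) (y : L) :
    ⁅h, (ad K L e ^ n) y⁆ = (n : K) • (ad K L e ^ n) y := by
  have hlie := lie_pow_succ_of_lie_eq_two_nsmul (lie_ad_ad (K := K) e f)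
    (by rw [hef, lie_ad_ad, hhe, map_nsmul]) n
  have : IsAddTorsionFree (Module.End K L) := .of_isTorsionFree K _
  rw [he, hef, Ring.lie_def, zero_mul, mul_zero, sub_zero, eq_comm,
    smul_eq_zero_iff_right n.succ_ne_zero] at hlie
  have hy := congr($hlie y)
  rwa [Module.End.mul_apply, LinearMap.sub_apply, Module.End.natCast_apply, LinearMap.zero_apply,
    ad_apply, sub_eq_zero, ← Nat.cast_smul_eq_nsmul K] at hy

variable (K) in
lemma lie_mem_ker_ad_inf_range_ad (he : ad K L e ^ 3 = 0) (hef : ⁅e, f⁆ = h)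
    (hhe : ⁅h, e⁆ = 2 • e) {x : L}
    (hx : x ∈ LinearMap.ker (ad K L e) ⊔ LinearMap.range (ad K L e)) :
    ⁅h, x⁆ ∈ LinearMap.ker (ad K L e) ⊓ LinearMap.range (ad K L e) := by
  have hhe' := lie_lie_of_lie_eq_two_nsmul hhe
  obtain ⟨z, hz, _, ⟨w, rfl⟩, rfl⟩ := Submodule.mem_sup.mp hx
  rw [LinearMap.mem_ker, ad_apply] at hz
  rw [lie_add]
  refine add_mem ⟨?_, ⁅f, z⁆, ?_⟩ ⟨LinearMap.mem_ker.mpr ?_, ⁅h, w⁆ + 2 • w, (hhe' w).symm⟩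
  · simpa [hz] using (hhe' z).symm
  · rw [ad_apply, ← hef, lie_lie, hz, lie_zero, sub_zero]
  · have hw : ⁅h, ⁅e, ⁅e, w⁆⁆⁆ = (2 : K) • ⁅e, ⁅e, w⁆⁆ := by
      simpa [sq] using lie_ad_pow_succ_apply_of_lie_eq_two_nsmul K hef hhe he w
    rw [ofNat_smul_eq_nsmul, hhe', hhe', lie_add, lie_nsmul, add_eq_right] at hw
    rw [ad_apply, ad_apply, hhe', hw]

variable (K) in
lemma eq_zero_of_lie_add_two_nsmul_eq_zero (he : IsNilpotent (ad K L e)) (hef : ⁅e, f⁆ = h)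
    (hhe : ⁅h, e⁆ = 2 • e) {z : L} (hez : ⁅e, z⁆ = 0) (hhz : ⁅h, z⁆ + 2 • z = 0) : z = 0 := by
  by_contra hz
  have hz' : ⁅h, z⁆ = (-2 : K) • z := by rw [eq_neg_of_add_eq_zero_left hhz]; module
  obtain ⟨n, hn⟩ := exists_eq_natCast_of_lie_relations_of_mem_ker he (lie_ad_ad e f)
    (by rw [hef, lie_ad_ad, hhe, map_nsmul]) hz hez (hef ▸ hz')
  norm_cast at hn

variable (K) in
lemma eq_of_isSl2Triple_of_isSl2Triple {f' : L} (he : IsNilpotent (ad K L e))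
    (t : IsSl2Triple h e f) (t' : IsSl2Triple h e f') : f = f' :=
  sub_eq_zero.mp <| eq_zero_of_lie_add_two_nsmul_eq_zero K he t.lie_e_f t.lie_h_e_nsmul
    (by rw [lie_sub, t.lie_e_f, t'.lie_e_f, sub_self])
    (by rw [lie_sub, t.lie_h_f_nsmul, t'.lie_h_f_nsmul]; module)

lemma exists_isSl2Triple_of_lie_eq [FiniteDimensional K L] (he : IsNilpotent (ad K L e))
    (he0 : e ≠ 0) (hef : ⁅e, f⁆ = h) (hhe : ⁅h, e⁆ = 2 • e) : ∃ f', IsSl2Triple h e f' := by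
  let C := LinearMap.ker (ad K L e)
  have hC : ∀ z ∈ C, (ad K L h + 2) z ∈ C := by
    intro z hz
    rw [LinearMap.mem_ker, ad_apply] at hz
    simpa [C, hz] using (lie_lie_of_lie_eq_two_nsmul hhe z).symm
  have hinj : Function.Injective ((ad K L h + 2).restrict hC) := by
    rw [← LinearMap.ker_eq_bot, LinearMap.ker_eq_bot']
    rintro ⟨z, hz⟩ hz'
    exact Subtype.ext <| eq_zero_of_lie_add_two_nsmul_eq_zero K he hef hhe hz
      (by simpa using congr(($hz' : L)))
  have hu : ⁅h, f⁆ + 2 • f ∈ C := by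
    rw [LinearMap.mem_ker, ad_apply, ← lie_lie_of_lie_eq_two_nsmul hhe, hef, lie_self]
  obtain ⟨⟨v, hv⟩, hvu⟩ := LinearMap.injective_iff_surjective.mp hinj ⟨_, hu⟩
  replace hvu : ⁅h, v⁆ + 2 • v = ⁅h, f⁆ + 2 • f := by
    simpa using congr(($hvu : L))
  replace hv : ⁅e, v⁆ = 0 := hv
  have h0 : h ≠ 0 := by
    rintro rfl
    have : IsAddTorsionFree L := .of_isTorsionFree K L
    rw [zero_lie, eq_comm, smul_eq_zero_iff_right two_ne_zero] at hhe
    exact he0 hhe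
  exact ⟨f - v, h0, by rw [lie_sub, hef, hv, sub_zero], hhe,
    by rw [lie_sub, eq_sub_of_add_eq hvu]; module⟩

lemma ad_sq_ne_zero_of_isSl2Triple (t : IsSl2Triple h e f) : ad K L e ^ 2 ≠ 0 := by
  intro hsq
  have hf : ⁅e, ⁅e, f⁆⁆ = 0 := by simpa [sq] using congr($hsq f)
  rw [t.lie_e_f, ← lie_skew, t.lie_h_e_smul K, neg_eq_zero,
    smul_eq_zero_iff_right two_ne_zero] at hf
  exact t.e_ne_zero hf

lemma exists_lie_eq_smul_of_ad_pow_three_ne_zero (he : IsNilpotent (ad K L e))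
    (he3 : ad K L e ^ 3 ≠ 0) (t : IsSl2Triple h e f) :
    ∃ (k : K) (w : L), k ≠ 0 ∧ ⁅h, ⁅e, w⁆⁆ = k • ⁅e, w⁆ ∧ ⁅e, ⁅e, w⁆⁆ ≠ 0 := by
  obtain ⟨n, hn, hn'⟩ : ∃ n, ad K L e ^ (n + 3) ≠ 0 ∧ ad K L e ^ (n + 3 + 1) = 0 := by
    by_contra! hall
    obtain ⟨N, hN⟩ := he
    exact Nat.rec (motive := fun n => ad K L e ^ (n + 3) ≠ 0) he3 hall N
      (pow_eq_zero_of_le (by omega) hN)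
  obtain ⟨y, hy⟩ := DFunLike.ne_iff.mp hn
  have hprim : t.HasPrimitiveVectorWith ((ad K L e ^ (n + 3)) y) ((n + 3 : ℕ) : K) :=
    ⟨hy, lie_ad_pow_succ_apply_of_lie_eq_two_nsmul K t.lie_e_f t.lie_h_e_nsmul hn' y,
      by rw [← ad_apply K, ← Module.End.mul_apply, ← pow_succ', hn', LinearMap.zero_apply]⟩
  set u := (ad K L e ^ (n + 3)) y
  have hffu : ⁅e, ⁅f, ⁅f, u⁆⁆⁆ = (2 * (n + 2 : K)) • ⁅f, u⁆ := by
    convert hprim.lie_e_pow_succ_toEnd_f 1 using 2 <;> norm_num [pow_two]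
    ring
  have hfu : ⁅e, ⁅f, u⁆⁆ = (n + 3 : K) • u := by simpa using hprim.lie_e_pow_succ_toEnd_f 0
  have hhfu : ⁅h, ⁅f, u⁆⁆ = (n + 1 : K) • ⁅f, u⁆ := by
    convert hprim.lie_h_pow_toEnd_f 1 using 2 <;> norm_num
    ring
  refine ⟨n + 1, ⁅f, ⁅f, u⁆⁆, by norm_cast, ?_, ?_⟩
  · rw [hffu, lie_smul, hhfu, smul_comm]
  · rw [hffu, lie_smul, hfu, smul_smul]
    refine smul_ne_zero ?_ hy
    norm_cast

end Characteristic

lemma exists_mem_forall_apply_add_eq_zero_of_anisotropic {K V : Type*} [Field K] [AddCommGroup V]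
    [Module K V] (β : V →ₗ[K] V →ₗ[K] K) (hβ : ∀ x, β x x = 0 → x = 0) (D : Submodule K V)
    [FiniteDimensional K D] (x : V) : ∃ d ∈ D, ∀ d' ∈ D, β d' (x + d) = 0 := by
  let Φ : D →ₗ[K] Module.Dual K D := (β.domRestrict₁₂ D D).flip
  have hinj : Function.Injective Φ := by
    rw [← LinearMap.ker_eq_bot, LinearMap.ker_eq_bot']
    intro d hd
    exact Subtype.ext (hβ d (by simpa [Φ] using! congr($hd d)))
  obtain ⟨d, hd⟩ := (LinearMap.injective_iff_surjective_of_finrank_eq_finrank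
    Subspace.dual_finrank_eq.symm).mp hinj (-(β.flip x).domRestrict D)
  refine ⟨d, d.2, fun d' hd' => ?_⟩
  rw [map_add, add_comm]
  exact add_eq_zero_iff_eq_neg.mpr congr($hd ⟨d', hd'⟩)

namespace IsCompactRealForm

variable {𝔤 : Type*} [LieRing 𝔤] [LieAlgebra ℂ 𝔤] {𝔨 : Submodule ℝ 𝔤} (h𝔨 : IsCompactRealForm 𝔨)

/-- The conjugation `σ` of `𝔤` with respect to the real form `𝔨`: the identity on `𝔨` and its
negative on `i𝔨`. It is only recorded as an `ℝ`-linear map. -/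
noncomputable def conj : 𝔤 →ₗ[ℝ] 𝔤 :=
  LinearMap.ofIsCompl h𝔨.isCompl 𝔨.subtype (-(Complex.I • 𝔨).subtype)

include h𝔨

lemma exists_add_I_smul (x : 𝔤) : ∃ a ∈ 𝔨, ∃ b ∈ 𝔨, x = a + Complex.I • b := by
  obtain ⟨a, ha, c, hc, rfl⟩ :=
    Submodule.mem_sup.mp (h𝔨.isCompl.sup_eq_top ▸ Submodule.mem_top (x := x))
  obtain ⟨b, hb, rfl⟩ := (Submodule.mem_smul_pointwise_iff_exists ..).mp hc
  exact ⟨a, ha, b, hb, rfl⟩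

lemma conj_of_mem {a : 𝔤} (ha : a ∈ 𝔨) : h𝔨.conj a = a :=
  LinearMap.ofIsCompl_apply_left h𝔨.isCompl ⟨a, ha⟩

lemma conj_of_mem_I_smul {b : 𝔤} (hb : b ∈ Complex.I • 𝔨) : h𝔨.conj b = -b :=
  LinearMap.ofIsCompl_apply_right h𝔨.isCompl ⟨b, hb⟩

lemma conj_add_I_smul {a b : 𝔤} (ha : a ∈ 𝔨) (hb : b ∈ 𝔨) :
    h𝔨.conj (a + Complex.I • b) = a - Complex.I • b := by
  rw [map_add, h𝔨.conj_of_mem ha,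
    h𝔨.conj_of_mem_I_smul (Submodule.smul_mem_pointwise_smul _ _ _ hb), sub_eq_add_neg]

lemma conj_conj (x : 𝔤) : h𝔨.conj (h𝔨.conj x) = x := by
  obtain ⟨a, ha, b, hb, rfl⟩ := h𝔨.exists_add_I_smul x
  rw [h𝔨.conj_add_I_smul ha hb, sub_eq_add_neg, ← smul_neg, h𝔨.conj_add_I_smul ha (neg_mem hb)]
  simp

lemma conj_lie (x y : 𝔤) : h𝔨.conj ⁅x, y⁆ = ⁅h𝔨.conj x, h𝔨.conj y⁆ := by
  have hexpand (a b c d : 𝔤) : ⁅a + Complex.I • b, c + Complex.I • d⁆ =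
      (⁅a, c⁆ - ⁅b, d⁆) + Complex.I • (⁅a, d⁆ + ⁅b, c⁆) := by
    simp only [add_lie, lie_add, smul_lie, lie_smul, smul_add, smul_smul, Complex.I_mul_I]
    module
  obtain ⟨a, ha, b, hb, rfl⟩ := h𝔨.exists_add_I_smul x
  obtain ⟨c, hc, d, hd, rfl⟩ := h𝔨.exists_add_I_smul y
  rw [hexpand, h𝔨.conj_add_I_smul (sub_mem (h𝔨.lie_mem _ ha _ hc) (h𝔨.lie_mem _ hb _ hd))
    (add_mem (h𝔨.lie_mem _ ha _ hd) (h𝔨.lie_mem _ hb _ hc)), h𝔨.conj_add_I_smul ha hb,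
    h𝔨.conj_add_I_smul hc hd, sub_eq_add_neg a, sub_eq_add_neg c, ← smul_neg, ← smul_neg, hexpand]
  simp only [neg_lie, lie_neg]
  module

lemma mem_I_smul_of_conj_eq_neg {x : 𝔤} (hx : h𝔨.conj x = -x) : x ∈ Complex.I • 𝔨 := by
  obtain ⟨a, ha, b, hb, rfl⟩ := h𝔨.exists_add_I_smul x
  rw [h𝔨.conj_add_I_smul ha hb] at hx
  obtain rfl : a = 0 := by linear_combination (norm := module) (2⁻¹ : ℂ) • hx
  rw [zero_add]
  exact Submodule.smul_mem_pointwise_smul _ _ _ hb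

lemma eq_zero_of_killingForm_conj_eq_zero {x : 𝔤} (hx : (killingForm ℂ 𝔤 x (h𝔨.conj x)).re = 0) :
    x = 0 := by
  have hnonpos {a : 𝔤} (ha : a ∈ 𝔨) : (killingForm ℂ 𝔤 a a).re ≤ 0 := by
    rcases eq_or_ne a 0 with rfl | h0
    · simp
    · exact (h𝔨.neg_def a ha h0).le
  obtain ⟨a, ha, b, hb, rfl⟩ := h𝔨.exists_add_I_smul x
  have hab : killingForm ℂ 𝔤 (a + Complex.I • b) (a - Complex.I • b)
      = killingForm ℂ 𝔤 a a + killingForm ℂ 𝔤 b b := by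
    simp only [map_add, map_sub, LinearMap.add_apply, map_smul, LinearMap.smul_apply, smul_eq_mul]
    linear_combination Complex.I * LieModule.traceForm_comm ℂ 𝔤 𝔤 b a
      - killingForm ℂ 𝔤 b b * Complex.I_mul_I
  rw [h𝔨.conj_add_I_smul ha hb, hab, Complex.add_re] at hx
  obtain rfl : a = 0 := by_contra fun h0 => by linarith [h𝔨.neg_def a ha h0, hnonpos hb]
  obtain rfl : b = 0 := by_contra fun h0 => by linarith [h𝔨.neg_def b hb h0, hnonpos ha]
  simp

lemma eq_zero_of_mem_I_smul {x : 𝔤} (hx : x ∈ Complex.I • 𝔨) (hxx : killingForm ℂ 𝔤 x x = 0) :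
    x = 0 :=
  h𝔨.eq_zero_of_killingForm_conj_eq_zero (by simp [h𝔨.conj_of_mem_I_smul hx, hxx])

lemma isKilling : IsKilling ℂ 𝔤 where
  killingCompl_top_eq_bot := by
    rw [eq_bot_iff]
    intro x hx
    rw [LieIdeal.mem_killingCompl] at hx
    refine (h𝔨.eq_zero_of_killingForm_conj_eq_zero ?_)
    rw [LieModule.traceForm_comm, hx _ (by simp), Complex.zero_re]

lemma eq_of_isSl2Triple_mem_I_smul {e h h' f f' : 𝔤}
    (t : IsSl2Triple h e f) (t' : IsSl2Triple h' e f')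
    (hh : h ∈ Complex.I • 𝔨) (hh' : h' ∈ Complex.I • 𝔨) : h = h' := by
  have hsub := sub_mem_ker_ad_inf_range_ad ℂ t t'
  exact sub_eq_zero.mp <| h𝔨.eq_zero_of_mem_I_smul (sub_mem hh hh') <|
    killingForm_self_eq_zero_of_mem_ker_ad_inf_range_ad hsub

variable [FiniteDimensional ℂ 𝔤] {e h : 𝔤}

lemma isNilpotent_ad_add_conj (hcomm : ⁅h, h𝔨.conj h⁆ = 0)
    (hreal : ∀ μ, (ad ℂ 𝔤 h).HasEigenvalue μ → μ.im = 0) :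
    IsNilpotent (ad ℂ 𝔤 (h + h𝔨.conj h)) := by
  refine isNilpotent_of_forall_hasEigenvalue_eq_zero fun μ hμ => ?_
  have hmaps : Set.MapsTo (ad ℂ 𝔤 h) ((ad ℂ 𝔤 (h + h𝔨.conj h)).eigenspace μ)
      ((ad ℂ 𝔤 (h + h𝔨.conj h)).eigenspace μ) :=
    Module.End.mapsTo_genEigenspace_of_comm
      (by rw [commute_iff_lie_eq, lie_ad_ad, add_lie, lie_self, ← lie_skew, hcomm]; simp) μ 1
  have : Nontrivial ((ad ℂ 𝔤 (h + h𝔨.conj h)).eigenspace μ) :=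
    Submodule.nontrivial_iff_ne_bot.mpr hμ
  obtain ⟨k, hk⟩ := Module.End.exists_eigenvalue ((ad ℂ 𝔤 h).restrict hmaps)
  obtain ⟨⟨x, hx⟩, hxk⟩ := hk.exists_hasEigenvector
  have hx0 : x ≠ 0 := by simpa using hxk.2
  have hhx : ⁅h, x⁆ = k • x := congr(($hxk.apply_eq_smul : 𝔤))
  have hk' : k.im = 0 :=
    hreal k (Module.End.hasEigenvalue_of_hasEigenvector (x := x) ⟨by simpa using hhx, hx0⟩)
  have hτx : ⁅h + h𝔨.conj h, x⁆ = μ • x := by simpa using hx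
  obtain ⟨r, rfl⟩ : ∃ r : ℝ, k = r := ⟨k.re, Complex.ext rfl (by simpa using hk')⟩
  have hσx : ⁅h𝔨.conj h, h𝔨.conj x⁆ = (r : ℂ) • h𝔨.conj x := by
    rw [← conj_lie, hhx, Complex.coe_smul, map_smul, Complex.coe_smul]
  have hμx : μ * killingForm ℂ 𝔤 x (h𝔨.conj x) = 0 := by
    rw [← smul_eq_mul, ← LinearMap.smul_apply, ← map_smul, ← hτx, add_lie, map_add,
      LinearMap.add_apply, LieModule.traceForm_apply_lie_apply' ℂ 𝔤 𝔤 (h𝔨.conj h), hhx, hσx]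
    simp
  refine (mul_eq_zero.mp hμx).resolve_right fun h0 => hx0 ?_
  exact h𝔨.eq_zero_of_killingForm_conj_eq_zero (by rw [h0, Complex.zero_re])

lemma mem_I_smul_of_lie_conj_eq_zero (hcomm : ⁅h, h𝔨.conj h⁆ = 0)
    (hreal : ∀ μ, (ad ℂ 𝔤 h).HasEigenvalue μ → μ.im = 0) : h ∈ Complex.I • 𝔨 := by
  have hτ : h + h𝔨.conj h = 0 := by
    have hσ : h𝔨.conj (h + h𝔨.conj h) = h + h𝔨.conj h := by rw [map_add, conj_conj, add_comm]
    refine h𝔨.eq_zero_of_killingForm_conj_eq_zero ?_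
    rw [hσ, killingForm_apply_apply, ← Module.End.mul_eq_comp, ← sq,
      (LinearMap.isNilpotent_trace_of_isNilpotent
        ((h𝔨.isNilpotent_ad_add_conj hcomm hreal).pow_of_pos two_ne_zero)).eq_zero, Complex.zero_re]
  exact h𝔨.mem_I_smul_of_conj_eq_neg (eq_neg_of_add_eq_zero_right hτ)

lemma exists_lie_eq_conj_mem_ker_sup_range (he : IsNilpotent (ad ℂ 𝔤 e)) :
    ∃ h f, ⁅e, f⁆ = h ∧ ⁅h, e⁆ = 2 • e ∧
      h𝔨.conj h ∈ LinearMap.ker (ad ℂ 𝔤 e) ⊔ LinearMap.range (ad ℂ 𝔤 e) := by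
  have := h𝔨.isKilling
  set D := LinearMap.ker (ad ℂ 𝔤 e) ⊓ LinearMap.range (ad ℂ 𝔤 e)
  let β : 𝔤 →ₗ[ℝ] 𝔤 →ₗ[ℝ] ℝ := LinearMap.mk₂ ℝ
    (fun a b => (killingForm ℂ 𝔤 a (h𝔨.conj b)).re) (by simp)
    (fun c a b => by rw [← Complex.coe_smul, map_smul]; simp) (by simp)
    (fun c a b => by rw [map_smul, ← Complex.coe_smul, map_smul]; simp)
  obtain ⟨y, hy⟩ := exists_lie_lie_eq_self he
  obtain ⟨_, ⟨hed, w, rfl⟩, hort⟩ := exists_mem_forall_apply_add_eq_zero_of_anisotropic β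
    (fun x => h𝔨.eq_zero_of_killingForm_conj_eq_zero) (D.restrictScalars ℝ) ⁅e, -(2 • y)⁆
  refine ⟨_, -(2 • y) + w, rfl, ?_, orthogonal_ker_ad_inf_range_ad_le e fun d hd => ?_⟩
  · replace hed : ⁅e, ⁅e, w⁆⁆ = 0 := hed
    rw [← lie_skew, lie_add, lie_add, hed, lie_neg, lie_neg, lie_nsmul, lie_nsmul, hy]
    module
  · rw [lie_add]
    refine Complex.ext (hort d hd) ?_
    simpa only [β, LinearMap.mk₂_apply, map_smul, LinearMap.smul_apply, smul_eq_mul,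
      Complex.I_mul_re, neg_eq_zero, ad_apply, Complex.zero_im] using
      hort (Complex.I • d) (D.smul_mem _ hd)

lemma exists_isSl2Triple_mem_I_smul (he0 : e ≠ 0) (he : ad ℂ 𝔤 e ^ 3 = 0) :
    ∃ h f, IsSl2Triple h e f ∧ h ∈ Complex.I • 𝔨 := by
  have hnil : IsNilpotent (ad ℂ 𝔤 e) := ⟨3, he⟩
  obtain ⟨h, f, hef, hhe, hσ⟩ := h𝔨.exists_lie_eq_conj_mem_ker_sup_range hnil
  obtain ⟨f', t⟩ := exists_isSl2Triple_of_lie_eq hnil he0 hef hhe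
  refine ⟨h, f', t, h𝔨.mem_I_smul_of_lie_conj_eq_zero ?_ fun μ hμ => ?_⟩
  · have hv := lie_mem_ker_ad_inf_range_ad ℂ he hef hhe hσ
    refine h𝔨.eq_zero_of_mem_I_smul (h𝔨.mem_I_smul_of_conj_eq_neg ?_) ?_
    · rw [conj_lie, conj_conj, lie_skew]
    · exact killingForm_self_eq_zero_of_mem_ker_ad_inf_range_ad hv
  · obtain ⟨x, hx⟩ := hμ.exists_hasEigenvector
    obtain ⟨n, rfl⟩ := exists_eq_intCast_of_lie_relations hnil (lie_ad_ad e f)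
      (by rw [hef, lie_ad_ad, hhe, map_nsmul]) hx.2 (hef ▸ hx.apply_eq_smul)
    simp

end IsCompactRealForm

section Orbit

variable {𝔤 : Type*} [LieRing 𝔤] [LieAlgebra ℂ 𝔤] {O : Set 𝔤} {e e' : 𝔤}

namespace IsNilpotentOrbit

variable (hO : IsNilpotentOrbit O)

include hO

lemma nonempty : O.Nonempty := by
  obtain ⟨e₀, -, rfl⟩ := hO
  exact MulAction.nonempty_orbit e₀

variable [FiniteDimensional ℂ 𝔤]

lemma toLieEquiv_apply_mem (he : e ∈ O) (g : adjointGroup 𝔤) :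
    adjointGroup.toLieEquiv g e ∈ O := by
  obtain ⟨e₀, -, rfl⟩ := hO
  exact MulAction.mem_orbit_of_mem_orbit g he

lemma exists_toLieEquiv_apply_eq (he : e ∈ O) (he' : e' ∈ O) :
    ∃ g : adjointGroup 𝔤, adjointGroup.toLieEquiv g e = e' := by
  obtain ⟨e₀, -, rfl⟩ := hO
  rwa [← MulAction.orbit_eq_iff.mpr he] at he'

lemma ad_pow_eq_zero_iff (he : e ∈ O) (he' : e' ∈ O) (n : ℕ) :
    ad ℂ 𝔤 e' ^ n = 0 ↔ ad ℂ 𝔤 e ^ n = 0 := by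
  obtain ⟨g, rfl⟩ := hO.exists_toLieEquiv_apply_eq he he'
  let c := (adjointGroup.toLieEquiv g).toLinearEquiv.conjRingEquiv
  have hc : ad ℂ 𝔤 (adjointGroup.toLieEquiv g e) = c (ad ℂ 𝔤 e) := (conj_ad_apply _ e).symm
  rw [hc, ← map_pow, map_eq_zero_iff c c.injective]

lemma isNilpotent_ad (he : e ∈ O) : IsNilpotent (ad ℂ 𝔤 e) := by
  have ⟨e₀, ⟨n, hn⟩, hO'⟩ := hO
  exact ⟨n, (hO.ad_pow_eq_zero_iff (hO' ▸ MulAction.mem_orbit_self e₀) he n).mpr hn⟩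

lemma orbitHeight_eq_iff (he : e ∈ O) {n : ℕ} (hn : n ≠ 0) :
    orbitHeight O = n ↔ ad ℂ 𝔤 e ^ n ≠ 0 ∧ ad ℂ 𝔤 e ^ (n + 1) = 0 := by
  have hset : {k | ∃ e' ∈ O, ad ℂ 𝔤 e' ^ k ≠ 0} = {k | ad ℂ 𝔤 e ^ k ≠ 0} := by
    ext k
    exact ⟨fun ⟨e', he', hk⟩ => mt (hO.ad_pow_eq_zero_iff he he' k).mpr hk, fun hk => ⟨e, he, hk⟩⟩
  obtain ⟨N, hN⟩ := hO.isNilpotent_ad he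
  have hbdd : BddAbove {k | ad ℂ 𝔤 e ^ k ≠ 0} :=
    ⟨N, fun k hk => not_lt.mp fun hlt => hk (pow_eq_zero_of_le hlt.le hN)⟩
  rw [orbitHeight, hset]
  constructor
  · rintro rfl
    refine ⟨Nat.sSup_mem (Set.nonempty_iff_ne_empty.mpr fun hempty => hn ?_) hbdd, ?_⟩
    · rw [hempty, csSup_empty, bot_eq_zero]
    · exact not_not.mp (notMem_of_csSup_lt (Nat.lt_succ_self _) hbdd)
  · rintro ⟨hn, hn'⟩
    exact IsGreatest.csSup_eq
      ⟨hn, fun k hk => not_lt.mp fun hlt => hk (pow_eq_zero_of_le hlt hn')⟩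

end IsNilpotentOrbit

variable [FiniteDimensional ℂ 𝔤] {𝔨 : Submodule ℝ 𝔤}

namespace IsMoorePenroseOrbit

lemma lie_eq_zero_of_lie_eq_smul (hMP : IsMoorePenroseOrbit 𝔨 O) (h𝔨 : IsCompactRealForm 𝔨)
    (hO : IsNilpotentOrbit O) (he : e ∈ O) {h f w : 𝔤} (t : IsSl2Triple h e f)
    (hh : h ∈ Complex.I • 𝔨) {k : ℂ} (hk : k ≠ 0) (hhw : ⁅h, ⁅e, w⁆⁆ = k • ⁅e, w⁆) :
    ⁅e, ⁅e, w⁆⁆ = 0 := by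
  set x := ⁅e, w⁆
  have hxh : ⁅x, h⁆ = -(k • x) := by rw [← lie_skew, hhw]
  obtain ⟨γ, hγ⟩ := adjointGroup.exists_toLieEquiv_apply_eq_add_lie x
  set g := adjointGroup.toLieEquiv γ
  have hgx : g x = x := by simpa using hγ x
  have hgh : g h = h - k • x := by
    rw [hγ h (by simp [hxh]), hxh, sub_eq_add_neg]
  obtain ⟨h', f', t', hh'⟩ := hMP _ (hO.toLieEquiv_apply_mem he γ)
  have t'' : IsSl2Triple (g.symm h') e (g.symm f') := by
    simpa only [g, LieEquiv.symm_apply_apply] using isSl2Triple_map g.symm t'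
  have hzmem := sub_mem_ker_ad_inf_range_ad ℂ t'' t
  set z := g.symm h' - h with hz
  have hdiff : h' - h = g (z - k • x) := by
    rw [hz, map_sub, map_sub, map_smul, hgx, hgh, g.apply_symm_apply]
    abel
  have heq : h' - h = 0 := by
    refine h𝔨.eq_zero_of_mem_I_smul (sub_mem hh' hh) ?_
    have hzz := killingForm_self_eq_zero_of_mem_ker_ad_inf_range_ad hzmem
    have hxz : killingForm ℂ 𝔤 x z = 0 := killingForm_lie_eq_zero_of_lie_eq_zero hzmem.1 w
    have hxx := killingForm_self_eq_zero_of_lie_eq_smul hk hhw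
    rw [hdiff, killingForm_of_equiv_apply]
    simp [hzz, hxz, hxx, LieModule.traceForm_comm ℂ 𝔤 𝔤 z x]
  rw [hdiff, map_eq_zero_iff g g.injective, sub_eq_zero] at heq
  have hez : ⁅e, z⁆ = 0 := hzmem.1
  rwa [heq, lie_smul, smul_eq_zero_iff_right hk] at hez

lemma ad_pow_three_eq_zero (hMP : IsMoorePenroseOrbit 𝔨 O) (h𝔨 : IsCompactRealForm 𝔨)
    (hO : IsNilpotentOrbit O) (he : e ∈ O) : ad ℂ 𝔤 e ^ 3 = 0 := by
  by_contra he3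
  obtain ⟨h, f, t, hh⟩ := hMP e he
  obtain ⟨k, w, hk, hhw, hew⟩ :=
    exists_lie_eq_smul_of_ad_pow_three_ne_zero (hO.isNilpotent_ad he) he3 t
  exact hew (hMP.lie_eq_zero_of_lie_eq_smul h𝔨 hO he t hh hk hhw)

end IsMoorePenroseOrbit

end Orbit

theorem theorem4p23_general {𝔤 : Type*} [LieRing 𝔤] [LieAlgebra ℂ 𝔤] [FiniteDimensional ℂ 𝔤]
    (𝔨 : Submodule ℝ 𝔤) (h𝔨 : IsCompactRealForm 𝔨) (O : Set 𝔤) (hO : IsNilpotentOrbit O) :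
    (IsMoorePenroseOrbit 𝔨 O ↔ orbitHeight O = 2) ∧
      (IsMoorePenroseOrbit 𝔨 O →
        ∀ e ∈ O, ∃! p : 𝔤 × 𝔤, IsSl2Triple p.1 e p.2 ∧ p.1 ∈ Complex.I • 𝔨) := by
  refine ⟨⟨fun hMP => ?_, fun hht e he => ?_⟩, fun hMP e he => ?_⟩
  · obtain ⟨e, he⟩ := hO.nonempty
    obtain ⟨h, f, t, -⟩ := hMP e he
    exact (hO.orbitHeight_eq_iff he two_ne_zero).mpr
      ⟨ad_sq_ne_zero_of_isSl2Triple t, hMP.ad_pow_three_eq_zero h𝔨 hO he⟩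
  · obtain ⟨he2, he3⟩ := (hO.orbitHeight_eq_iff he two_ne_zero).mp hht
    have he0 : e ≠ 0 := by
      rintro rfl
      simp at he2
    exact h𝔨.exists_isSl2Triple_mem_I_smul he0 he3
  · obtain ⟨h, f, t, hh⟩ := hMP e he
    refine ⟨(h, f), ⟨t, hh⟩, ?_⟩
    rintro ⟨h', f'⟩ ⟨t', hh'⟩
    obtain rfl : h' = h := h𝔨.eq_of_isSl2Triple_mem_I_smul t' t hh' hh
    exact congrArg _ (eq_of_isSl2Triple_of_isSl2Triple ℂ (hO.isNilpotent_ad he) t' t)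

theorem theorem4p23 {𝔤 : Type*} [LieRing 𝔤] [LieAlgebra ℂ 𝔤] [FiniteDimensional ℂ 𝔤]
    [LieAlgebra.IsSimple ℂ 𝔤] (𝔨 : Submodule ℝ 𝔤) (h𝔨 : IsCompactRealForm 𝔨)
    (O : Set 𝔤) (hO : IsNilpotentOrbit O) (hO0 : O ≠ {0}) :
    (IsMoorePenroseOrbit 𝔨 O ↔ orbitHeight O = 2) ∧
      (IsMoorePenroseOrbit 𝔨 O →
        ∀ e ∈ O, ∃! p : 𝔤 × 𝔤, IsSl2Triple p.1 e p.2 ∧ p.1 ∈ Complex.I • 𝔨) :=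
  theorem4p23_general 𝔨 h𝔨 O hO
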